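/- Let $\mathbb{F}$ be a field, let $n\ge 1$ be an integer, and let $U_n(\mathbb{F})$ be the group of $n\times n$ upper-triangular matrices over $\mathbb{F}$ with all diagonal entries equal to $1$. Put $d=\lceil\log_2 n\rceil$. Then $U_n(\mathbb{F})$ has a subgroup that is generated by two (not necessarily distinct) elements and has derived length $d$ if and only if $$\tfrac{21}{32}\,2^d<n\le 2^d.$$ Here the derived length of a group $G$ is the least $k\ge 0$ with $G^{(k)}=1$, where $G^{(0)}=G$ and $G^{(k+1)}=[G^{(k)},G^{(k)}]$. -/

import Mathlib

/-- `U_n(F)`: the group of `n × n` upper-triangular matrices over `F` with `1`s on the main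
diagonal and `0`s below it, as a subgroup of `GL_n(F)`. -/
def unitriangularGroup (n : ℕ) (F : Type*) [Field F] : Subgroup (GL (Fin n) F) where
  carrier := {A | (∀ i : Fin n, A i i = 1) ∧ ∀ i j : Fin n, j < i → A i j = 0}
  one_mem' := by
    refine ⟨fun i => by simp, fun i j hij => ?_⟩
    simp [Matrix.one_apply_ne hij.ne']
  mul_mem' := by
    rintro A B ⟨hA1, hA0⟩ ⟨hB1, hB0⟩
    refine ⟨fun i => ?_, fun i j hij => ?_⟩
    · rw [Units.val_mul, Matrix.mul_apply, Finset.sum_eq_single i]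
      · rw [hA1, hB1, one_mul]
      · intro k _ hk
        rcases lt_or_gt_of_ne hk with h | h
        · rw [hA0 i k h, zero_mul]
        · rw [hB0 k i h, mul_zero]
      · intro h
        exact absurd (Finset.mem_univ i) h
    · rw [Units.val_mul, Matrix.mul_apply]
      refine Finset.sum_eq_zero fun k _ => ?_
      rcases lt_or_ge k i with h | h
      · rw [hA0 i k h, zero_mul]
      · rw [hB0 k j (lt_of_lt_of_le hij h), mul_zero]
  inv_mem' := by
    rintro A ⟨hA1, hA0⟩
    have hT : Matrix.BlockTriangular (A : Matrix (Fin n) (Fin n) F) id := fun i j hij =>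
      hA0 i j hij
    have hI : Matrix.BlockTriangular
        ((A⁻¹ : GL (Fin n) F) : Matrix (Fin n) (Fin n) F) id := by
      haveI : Invertible (A : Matrix (Fin n) (Fin n) F) := A.invertible
      rw [Matrix.coe_units_inv]
      exact Matrix.blockTriangular_inv_of_blockTriangular hT
    refine ⟨fun i => ?_, fun i j hij => hI hij⟩
    have h : ((A * A⁻¹ : GL (Fin n) F) : Matrix (Fin n) (Fin n) F) i i = 1 := by simp
    rw [Units.val_mul, Matrix.mul_apply, Finset.sum_eq_single i, hA1, one_mul] at h
    · exact h
    · intro k _ hk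
      rcases lt_or_gt_of_ne hk with h | h
      · rw [hA0 i k h, zero_mul]
      · rw [hI h, mul_zero]
    · intro h
      exact absurd (Finset.mem_univ i) h

/-- A subgroup is `2`-generated if it is generated by two (not necessarily distinct) elements. -/
def IsTwoGenerated {G : Type*} [Group G] (H : Subgroup G) : Prop :=
  ∃ a b : G, H = Subgroup.closure {a, b}

/-- `G` has derived length `d`: `d` is the least `k` with `G^(k) = 1`. -/
def HasDerivedLength (G : Type*) [Group G] (d : ℕ) : Prop :=
  IsLeast {k : ℕ | derivedSeries G k = ⊥} d

/-! Write group elements as 1 + x and filter x by superdiagonals. Modulo deeper layers a group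
commutator is the Lie bracket of the two x's, and brackets add depths. Depth therefore at least
doubles at each derived step, which gives G^(d) = 1 since n ≤ 2^d; the question is whether G^(d-1)
can be nontrivial.

Because the bracket is alternating, doubling gains one more whenever the leading part is spanned by
a single element. For G = ⟨1 + x, 1 + y⟩, G' is led by one element c at depth 2, so G'' has depth 5
and is led by [c,[c,x]] and [c,[c,y]]; G''' is led by their bracket at depth 10, so G'''' has depth
21. Afterwards only doubling is guaranteed (`derivedIn_closure_pair_sub_one_mem`).

These depths are attained. Two generators are built from a binary word s so that entries of iterated
brackets detect subwords of s. As with Lyndon words, if the word vw precedes wv, then the bracket of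
elements led by v and w is led by vw, with nonzero coefficient over any field
(`HasLead.commutator`). Explicit brackets reach depth 21 with three distinct leading words, and
three words of equal length reproduce themselves at double length (`exists_three_derivedLead`). -/

open Matrix
open scoped commutatorElement

/-! ### The superdiagonal filtration and commutators modulo deeper layers -/

section Layers

variable {n : ℕ} {F : Type*} [Field F]

/-- The matrices that vanish strictly below the `m`-th superdiagonal. -/
def layer (n : ℕ) (F : Type*) [Field F] (m : ℕ) : Submodule F (Matrix (Fin n) (Fin n) F) where
  carrier := {x | ∀ i j : Fin n, (j : ℕ) < i + m → x i j = 0}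
  zero_mem' := fun _ _ _ => rfl
  add_mem' := fun {x y} hx hy i j h => by simp [hx i j h, hy i j h]
  smul_mem' := fun c x hx i j h => by simp [hx i j h]

theorem layer_anti {m k : ℕ} (h : m ≤ k) : layer n F k ≤ layer n F m :=
  fun _ hx i j hij => hx i j (by omega)

theorem eq_zero_of_mem_layer {m : ℕ} (h : n ≤ m) {x : Matrix (Fin n) (Fin n) F}
    (hx : x ∈ layer n F m) : x = 0 := by
  ext i j
  exact hx i j (by omega)

theorem mul_mem_layer {m k : ℕ} {x y : Matrix (Fin n) (Fin n) F}
    (hx : x ∈ layer n F m) (hy : y ∈ layer n F k) : x * y ∈ layer n F (m + k) := by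
  intro i j hij
  rw [Matrix.mul_apply]
  refine Finset.sum_eq_zero fun l _ => ?_
  rcases lt_or_ge (l : ℕ) (i + m) with h | h
  · rw [hx i l h, zero_mul]
  · rw [hy l j (by omega), mul_zero]

theorem lie_mem_layer {m k : ℕ} {x y : Matrix (Fin n) (Fin n) F}
    (hx : x ∈ layer n F m) (hy : y ∈ layer n F k) : ⁅x, y⁆ ∈ layer n F (m + k) := by
  rw [Ring.lie_def]
  refine sub_mem (mul_mem_layer hx hy) ?_
  rw [add_comm m k]
  exact mul_mem_layer hy hx

/-- On the first diagonal where it can be nonzero, a product has a single contributing term. -/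
theorem mul_apply_of_mem_layer {m k : ℕ} {x y : Matrix (Fin n) (Fin n) F}
    (hx : x ∈ layer n F m) (hy : y ∈ layer n F k) {i l j : Fin n}
    (hl : (l : ℕ) = i + m) (hj : (j : ℕ) = l + k) : (x * y) i j = x i l * y l j := by
  rw [Matrix.mul_apply]
  refine Finset.sum_eq_single l (fun t _ ht => ?_) (by simp)
  have ht' : (t : ℕ) ≠ l := fun h => ht (Fin.ext h)
  rcases lt_or_ge (t : ℕ) (i + m) with h | h
  · rw [hx i t h, zero_mul]
  · rw [hy t j (by omega), mul_zero]

theorem one_mem_layer : (1 : Matrix (Fin n) (Fin n) F) ∈ layer n F 0 := by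
  intro i j h
  rw [Matrix.one_apply_ne]
  rintro rfl
  omega

theorem mem_unitriangularGroup_iff {g : GL (Fin n) F} :
    g ∈ unitriangularGroup n F ↔ (g : Matrix (Fin n) (Fin n) F) - 1 ∈ layer n F 1 := by
  constructor
  · rintro ⟨h1, h0⟩ i j hij
    rcases eq_or_ne i j with rfl | hne
    · rw [Matrix.sub_apply, h1 i, Matrix.one_apply_eq, sub_self]
    · have : (i : ℕ) ≠ j := fun h => hne (Fin.ext h)
      rw [Matrix.sub_apply, h0 i j (Fin.lt_def.2 (by omega)), Matrix.one_apply_ne hne, sub_self]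
  · intro h
    refine ⟨fun i => ?_, fun i j hij => ?_⟩
    · have := h i i (by omega)
      rwa [Matrix.sub_apply, Matrix.one_apply_eq, sub_eq_zero] at this
    · have := h i j (by have := Fin.lt_def.1 hij; omega)
      rwa [Matrix.sub_apply, Matrix.one_apply_ne hij.ne', sub_zero] at this

theorem coe_mem_layer_zero {g : GL (Fin n) F} (hg : g ∈ unitriangularGroup n F) :
    (g : Matrix (Fin n) (Fin n) F) ∈ layer n F 0 := by
  have := add_mem (layer_anti (Nat.zero_le 1) (mem_unitriangularGroup_iff.1 hg)) one_mem_layer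
  rwa [sub_add_cancel] at this

theorem exists_coe_sub_one_eq {x : Matrix (Fin n) (Fin n) F} (hx : x ∈ layer n F 1) :
    ∃ g : GL (Fin n) F, (g : Matrix (Fin n) (Fin n) F) - 1 = x := by
  have hpow : ∀ k : ℕ, x ^ k ∈ layer n F k := by
    intro k
    induction k with
    | zero => simpa using one_mem_layer
    | succ k ih =>
      rw [pow_succ]
      exact mul_mem_layer ih hx
  have hnil : IsNilpotent x := ⟨n, eq_zero_of_mem_layer le_rfl (hpow n)⟩
  obtain ⟨g, hg⟩ := hnil.isUnit_one_add
  exact ⟨g, by rw [hg]; abel⟩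

/-- Both sides equal (gh - hg)(hg)⁻¹, since the identity parts cancel in the bracket. -/
theorem commutator_sub_one (g h : GL (Fin n) F) :
    ((⁅g, h⁆ : GL (Fin n) F) : Matrix (Fin n) (Fin n) F) - 1 =
      ⁅(g : Matrix (Fin n) (Fin n) F) - 1, (h : Matrix (Fin n) (Fin n) F) - 1⁆ *
        (((h * g)⁻¹ : GL (Fin n) F) : Matrix (Fin n) (Fin n) F) := by
  have h1 : ⁅(g : Matrix (Fin n) (Fin n) F) - 1, (h : Matrix (Fin n) (Fin n) F) - 1⁆ =
      ((g * h : GL (Fin n) F) : Matrix (Fin n) (Fin n) F) -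
        ((h * g : GL (Fin n) F) : Matrix (Fin n) (Fin n) F) := by
    rw [Ring.lie_def, Units.val_mul, Units.val_mul]
    noncomm_ring
  rw [h1, sub_mul, ← Units.val_mul, ← Units.val_mul, mul_inv_cancel, Units.val_one,
    commutatorElement_def]
  congr 2
  group

/-- The factor (hg)⁻¹ in `commutator_sub_one` is 1 plus a matrix of depth 1, so it only adds an
error in layer k + 1, which M absorbs. -/
theorem commutator_sub_one_mem {M : Submodule F (Matrix (Fin n) (Fin n) F)} {k : ℕ}
    (hM : M ≤ layer n F k) (hM' : layer n F (k + 1) ≤ M) {g h : GL (Fin n) F}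
    (hg : g ∈ unitriangularGroup n F) (hh : h ∈ unitriangularGroup n F)
    (hgh : ⁅(g : Matrix (Fin n) (Fin n) F) - 1, (h : Matrix (Fin n) (Fin n) F) - 1⁆ ∈ M) :
    ((⁅g, h⁆ : GL (Fin n) F) : Matrix (Fin n) (Fin n) F) - 1 ∈ M := by
  have hz := mem_unitriangularGroup_iff.1 (inv_mem (mul_mem hh hg))
  rw [commutator_sub_one, ← sub_add_cancel (((h * g)⁻¹ : GL (Fin n) F) : Matrix (Fin n) (Fin n) F) 1, mul_add,
    mul_one]
  exact add_mem (hM' (mul_mem_layer (hM hgh) hz)) hgh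

/-- The unitriangular matrices `1 + x` with `x` in a submodule `M` squeezed between two layers. -/
def oneAddSubgroup (M : Submodule F (Matrix (Fin n) (Fin n) F)) (m : ℕ) (hm : 1 ≤ m)
    (hM : M ≤ layer n F m) (hM' : layer n F (2 * m) ≤ M) : Subgroup (GL (Fin n) F) where
  carrier := {g | (g : Matrix (Fin n) (Fin n) F) - 1 ∈ M}
  one_mem' := by simp
  mul_mem' := by
    intro g h hg hh
    have : ((g * h : GL (Fin n) F) : Matrix (Fin n) (Fin n) F) - 1 =
        ((g : Matrix (Fin n) (Fin n) F) - 1) + ((h : Matrix (Fin n) (Fin n) F) - 1) +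
        ((g : Matrix (Fin n) (Fin n) F) - 1) * ((h : Matrix (Fin n) (Fin n) F) - 1) := by
      rw [Units.val_mul]
      noncomm_ring
    rw [Set.mem_ofPred_eq, this]
    refine add_mem (add_mem hg hh) (hM' ?_)
    rw [two_mul]
    exact mul_mem_layer (hM hg) (hM hh)
  inv_mem' := by
    intro g hg
    have hU : g ∈ unitriangularGroup n F :=
      mem_unitriangularGroup_iff.2 (layer_anti hm (hM hg))
    have hgi : (g : Matrix (Fin n) (Fin n) F) * ((g⁻¹ : GL (Fin n) F) : Matrix _ _ F) = 1 := by
      rw [← Units.val_mul, mul_inv_cancel, Units.val_one]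
    have : ((g⁻¹ : GL (Fin n) F) : Matrix (Fin n) (Fin n) F) - 1 =
        -((g : Matrix (Fin n) (Fin n) F) - 1) +
        ((g : Matrix (Fin n) (Fin n) F) - 1) * ((g : Matrix (Fin n) (Fin n) F) - 1) *
          ((g⁻¹ : GL (Fin n) F) : Matrix (Fin n) (Fin n) F) := by
      rw [mul_assoc, sub_mul _ _ ((g⁻¹ : GL (Fin n) F) : Matrix (Fin n) (Fin n) F), hgi, one_mul]
      simp only [mul_sub, sub_mul, hgi, mul_one, one_mul]
      abel
    rw [Set.mem_ofPred_eq, this]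
    refine add_mem (neg_mem hg) (hM' ?_)
    have := mul_mem_layer (mul_mem_layer (hM hg) (hM hg)) (coe_mem_layer_zero (inv_mem hU))
    rwa [add_zero, ← two_mul] at this

theorem mem_oneAddSubgroup {M : Submodule F (Matrix (Fin n) (Fin n) F)} {m : ℕ} {hm : 1 ≤ m}
    {hM : M ≤ layer n F m} {hM' : layer n F (2 * m) ≤ M} {g : GL (Fin n) F} :
    g ∈ oneAddSubgroup M m hm hM hM' ↔ (g : Matrix (Fin n) (Fin n) F) - 1 ∈ M := Iff.rfl

/-- The unitriangular matrices congruent to `1` modulo the `m`-th layer. -/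
def layerSubgroup (n : ℕ) (F : Type*) [Field F] (m : ℕ) (hm : 1 ≤ m) : Subgroup (GL (Fin n) F) :=
  oneAddSubgroup (layer n F m) m hm le_rfl (layer_anti (by omega))

theorem layerSubgroup_eq_bot {m : ℕ} (hm : 1 ≤ m) (h : n ≤ m) : layerSubgroup n F m hm = ⊥ := by
  rw [eq_bot_iff]
  intro g hg
  rw [Subgroup.mem_bot]
  exact Units.ext (sub_eq_zero.1 (eq_zero_of_mem_layer h hg))

end Layers

/-! ### Derived series computed inside an ambient group -/

section RelativeDerivedSeries

variable {G : Type*} [Group G]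

/-- The derived series of a subgroup, as subgroups of the ambient group. -/
def derivedIn (K : Subgroup G) : ℕ → Subgroup G
  | 0 => K
  | k + 1 => ⁅derivedIn K k, derivedIn K k⁆

theorem derivedIn_zero (K : Subgroup G) : derivedIn K 0 = K := rfl

theorem derivedIn_succ (K : Subgroup G) (k : ℕ) :
    derivedIn K (k + 1) = ⁅derivedIn K k, derivedIn K k⁆ := rfl

theorem map_derivedSeries_eq_derivedIn {A : Type*} [Group A] (φ : A →* G) (k : ℕ) :
    (derivedSeries A k).map φ = derivedIn φ.range k := by
  induction k with
  | zero => rw [derivedSeries_zero, derivedIn_zero, MonoidHom.range_eq_map]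
  | succ k ih => rw [derivedSeries_succ, derivedIn_succ, Subgroup.map_commutator, ih]

theorem derivedSeries_eq_bot_iff {A : Type*} [Group A] (φ : A →* G) (hφ : Function.Injective φ)
    (k : ℕ) : derivedSeries A k = ⊥ ↔ derivedIn φ.range k = ⊥ := by
  rw [← map_derivedSeries_eq_derivedIn, Subgroup.map_eq_bot_iff_of_injective _ hφ]

theorem derivedIn_succ_le (K : Subgroup G) (k : ℕ) : derivedIn K (k + 1) ≤ derivedIn K k :=
  Subgroup.commutator_le.2 fun _ hg _ hh => by
    rw [commutatorElement_def]
    exact mul_mem (mul_mem (mul_mem hg hh) (inv_mem hg)) (inv_mem hh)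

theorem derivedIn_antitone (K : Subgroup G) : Antitone (derivedIn K) :=
  antitone_nat_of_succ_le (derivedIn_succ_le K)

theorem conj_mem_derivedIn {K : Subgroup G} {g : G} (hg : g ∈ K) (k : ℕ) {h : G}
    (hh : h ∈ derivedIn K k) : g * h * g⁻¹ ∈ derivedIn K k := by
  induction k generalizing h with
  | zero => exact mul_mem (mul_mem hg hh) (inv_mem hg)
  | succ k ih =>
    have hle : derivedIn K (k + 1) ≤ (derivedIn K (k + 1)).comap (MulAut.conj g).toMonoidHom := by
      rw [derivedIn_succ, Subgroup.commutator_le]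
      intro x hx y hy
      rw [Subgroup.mem_comap, map_commutatorElement]
      exact Subgroup.commutator_mem_commutator (ih hx) (ih hy)
    exact hle hh

theorem commutator_mem_derivedIn {K : Subgroup G} {g : G} (hg : g ∈ K) {k : ℕ} {h : G}
    (hh : h ∈ derivedIn K k) : ⁅g, h⁆ ∈ derivedIn K k := by
  rw [commutatorElement_def]
  exact mul_mem (conj_mem_derivedIn hg k hh) (inv_mem hh)

theorem commutator_mem_derivedIn_succ {K : Subgroup G} {k : ℕ} {g h : G}
    (hg : g ∈ derivedIn K k) (hh : h ∈ derivedIn K k) : ⁅g, h⁆ ∈ derivedIn K (k + 1) :=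
  Subgroup.commutator_mem_commutator hg hh

/-- A subgroup normalized by `a` and `b` that contains `⁅a, b⁆` contains the derived subgroup of
`⟨a, b⟩`. -/
theorem commutator_closure_pair_le {a b : G} {T : Subgroup G}
    (hT : ∀ g ∈ Subgroup.closure {a, b}, ∀ h ∈ T, g * h * g⁻¹ ∈ T) (hab : ⁅a, b⁆ ∈ T) :
    ⁅Subgroup.closure {a, b}, Subgroup.closure {a, b}⁆ ≤ T := by
  -- Extends from the generators in one argument only; it is applied below once per argument, with
  -- the swap in between.
  have key : ∀ h : G, ⁅a, h⁆ ∈ T → ⁅b, h⁆ ∈ T → ∀ g ∈ Subgroup.closure {a, b}, ⁅g, h⁆ ∈ T := by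
    intro h ha hb g hg
    induction hg using Subgroup.closure_induction with
    | mem x hx => rcases hx with rfl | rfl <;> assumption
    | one => rw [commutatorElement_one_left]; exact one_mem T
    | mul x y hx _ ihx ihy =>
      have : ⁅x * y, h⁆ = x * ⁅y, h⁆ * x⁻¹ * ⁅x, h⁆ := by
        simp only [commutatorElement_def]; group
      rw [this]
      exact mul_mem (hT x hx _ ihy) ihx
    | inv x hx ih =>
      have : ⁅x⁻¹, h⁆ = x⁻¹ * ⁅x, h⁆⁻¹ * x⁻¹⁻¹ := by
        simp only [commutatorElement_def]; group
      rw [this]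
      exact hT _ (inv_mem hx) _ (inv_mem ih)
  have hswap : ∀ x y : G, ⁅x, y⁆ ∈ T → ⁅y, x⁆ ∈ T := fun x y h => by
    rw [← commutatorElement_inv]; exact inv_mem h
  have hself : ∀ x : G, ⁅x, x⁆ ∈ T := fun x => by rw [commutatorElement_self]; exact one_mem T
  rw [Subgroup.commutator_le]
  intro g hg h hh
  exact key h (hswap _ _ (key a (hself a) (hswap _ _ hab) h hh))
    (hswap _ _ (key b hab (hself b) h hh)) g hg

end RelativeDerivedSeries

/-! ### Depth of the derived subgroups of a two-generated group -/

section UpperBound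

attribute [local instance] LieRing.ofAssociativeRing

variable {n : ℕ} {F : Type*} [Field F]

/-- The matrices congruent to a combination of `x` and `y` modulo the `m`-th layer. -/
def pairLayer (x y : Matrix (Fin n) (Fin n) F) (m : ℕ) :
    Submodule F (Matrix (Fin n) (Fin n) F) :=
  Submodule.span F {x, y} ⊔ layer n F m

theorem mem_pairLayer {x y w : Matrix (Fin n) (Fin n) F} {m : ℕ} :
    w ∈ pairLayer x y m ↔ ∃ p q : F, ∃ r ∈ layer n F m, w = p • x + q • y + r := by
  rw [pairLayer, Submodule.mem_sup]
  constructor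
  · rintro ⟨s, hs, r, hr, rfl⟩
    obtain ⟨p, q, rfl⟩ := Submodule.mem_span_pair.1 hs
    exact ⟨p, q, r, hr, rfl⟩
  · rintro ⟨p, q, r, hr, rfl⟩
    exact ⟨_, Submodule.mem_span_pair.2 ⟨p, q, rfl⟩, r, hr, rfl⟩

theorem layer_le_pairLayer (x y : Matrix (Fin n) (Fin n) F) (m : ℕ) :
    layer n F m ≤ pairLayer x y m := le_sup_right

theorem left_mem_pairLayer (x y : Matrix (Fin n) (Fin n) F) (m : ℕ) : x ∈ pairLayer x y m :=
  mem_pairLayer.2 ⟨1, 0, 0, zero_mem _, by simp⟩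

theorem right_mem_pairLayer (x y : Matrix (Fin n) (Fin n) F) (m : ℕ) : y ∈ pairLayer x y m :=
  mem_pairLayer.2 ⟨0, 1, 0, zero_mem _, by simp⟩

theorem pairLayer_le {x y : Matrix (Fin n) (Fin n) F} {k m : ℕ} (hx : x ∈ layer n F k)
    (hy : y ∈ layer n F k) (hkm : k ≤ m) : pairLayer x y m ≤ layer n F k :=
  sup_le (Submodule.span_le.2 (by rintro _ (rfl | rfl) <;> assumption)) (layer_anti hkm)

theorem lie_mem_pairLayer {c x y w : Matrix (Fin n) (Fin n) F} {k m : ℕ} (hc : c ∈ layer n F k)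
    (hw : w ∈ pairLayer x y m) : ⁅c, w⁆ ∈ pairLayer ⁅c, x⁆ ⁅c, y⁆ (k + m) := by
  obtain ⟨p, q, r, hr, rfl⟩ := mem_pairLayer.1 hw
  exact mem_pairLayer.2 ⟨p, q, _, lie_mem_layer hc hr, by simp only [lie_add, lie_smul]⟩

/-- An alternating form on the span of two elements has image spanned by one: the coefficient of ⁅x,
y⁆ is a 2 × 2 determinant. Taking y = 0 gives the extra gain in depth. -/
theorem lie_mem_pairLayer_self {x y w z : Matrix (Fin n) (Fin n) F} {k : ℕ}
    (hx : x ∈ layer n F k) (hy : y ∈ layer n F k) (hw : w ∈ pairLayer x y (k + 1))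
    (hz : z ∈ pairLayer x y (k + 1)) : ⁅w, z⁆ ∈ pairLayer ⁅x, y⁆ 0 (2 * k + 1) := by
  have hzk := pairLayer_le hx hy (Nat.le_succ k) hz
  obtain ⟨p, q, r, hr, rfl⟩ := mem_pairLayer.1 hw
  obtain ⟨p', q', r', hr', rfl⟩ := mem_pairLayer.1 hz
  have hxr := lie_mem_layer (add_mem (Submodule.smul_mem _ p hx) (Submodule.smul_mem _ q hy)) hr'
  have hrz := lie_mem_layer hr hzk
  refine mem_pairLayer.2 ⟨p * q' - q * p', 0, ⁅p • x + q • y, r'⁆ +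
    ⁅r, p' • x + q' • y + r'⁆, add_mem (layer_anti (by omega) hxr) (layer_anti (by omega) hrz), ?_⟩
  rw [add_lie _ r, lie_add _ _ r', smul_zero, add_zero, ← add_assoc]
  congr 2
  simp only [lie_add, add_lie, lie_smul, smul_lie, lie_self, smul_zero, zero_add, add_zero]
  rw [← lie_skew x y]
  module

/-- The bracket of c with itself vanishes, ⁅r, r'⁆ already has depth 2k + 2, and what is left is ⁅c,
t r' - t' r⁆. -/
theorem lie_smul_add_mem_pairLayer {c x y r r' : Matrix (Fin n) (Fin n) F} {k : ℕ}
    (hc : c ∈ layer n F k) (hx : x ∈ layer n F (k + 1)) (hy : y ∈ layer n F (k + 1))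
    (hr : r ∈ pairLayer x y (k + 2)) (hr' : r' ∈ pairLayer x y (k + 2)) (t t' : F) :
    ⁅t • c + r, t' • c + r'⁆ ∈ pairLayer ⁅c, x⁆ ⁅c, y⁆ (k + (k + 2)) := by
  have heq : ⁅t • c + r, t' • c + r'⁆ = ⁅c, t • r' - t' • r⁆ + ⁅r, r'⁆ := by
    simp only [lie_add, add_lie, lie_sub, lie_smul, smul_lie, lie_self, smul_zero]
    rw [← lie_skew c r]
    module
  rw [heq]
  have hrr := lie_mem_layer (pairLayer_le hx hy (Nat.le_succ _) hr)
    (pairLayer_le hx hy (Nat.le_succ _) hr')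
  exact add_mem (lie_mem_pairLayer hc
    (sub_mem (Submodule.smul_mem _ _ hr') (Submodule.smul_mem _ _ hr)))
    (layer_le_pairLayer _ _ _ (layer_anti (by omega) hrr))

theorem lie_smul_add_mem_pairLayer_of_mem {c x y z r : Matrix (Fin n) (Fin n) F} {k : ℕ}
    (hx : x ∈ layer n F 1) (hy : y ∈ layer n F 1) (hc : c ∈ layer n F k)
    (hz : z ∈ pairLayer x y 2) (hr : r ∈ pairLayer ⁅c, x⁆ ⁅c, y⁆ (k + 2)) (t : F) :
    ⁅z, t • c + r⁆ ∈ pairLayer ⁅c, x⁆ ⁅c, y⁆ (k + 2) := by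
  have hcz : ⁅z, c⁆ ∈ pairLayer ⁅c, x⁆ ⁅c, y⁆ (k + 2) := by
    rw [← lie_skew z c]
    exact neg_mem (lie_mem_pairLayer hc hz)
  have hzr := lie_mem_layer (pairLayer_le hx hy one_le_two hz)
    (pairLayer_le (lie_mem_layer hc hx) (lie_mem_layer hc hy) (Nat.le_succ _) hr)
  rw [lie_add, lie_smul]
  exact add_mem (Submodule.smul_mem _ _ hcz)
    (layer_le_pairLayer _ _ _ (layer_anti (by omega) hzr))

theorem mul_mem_of_layer_le {M : Submodule F (Matrix (Fin n) (Fin n) F)} {k : ℕ}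
    (hM : M ≤ layer n F k) (hM' : layer n F (k + 1) ≤ M) {g : GL (Fin n) F}
    (hg : g ∈ unitriangularGroup n F) {w : Matrix (Fin n) (Fin n) F} (hw : w ∈ M) :
    w * (g : Matrix (Fin n) (Fin n) F) ∈ M := by
  rw [← sub_add_cancel (g : Matrix (Fin n) (Fin n) F) 1, mul_add, mul_one]
  exact add_mem (hM' (mul_mem_layer (hM hw) (mem_unitriangularGroup_iff.1 hg))) hw

theorem conj_sub_one (g h : GL (Fin n) F) :
    ((g * h * g⁻¹ : GL (Fin n) F) : Matrix (Fin n) (Fin n) F) - 1 =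
      ((h : Matrix (Fin n) (Fin n) F) - 1) +
      ⁅(g : Matrix (Fin n) (Fin n) F) - 1, (h : Matrix (Fin n) (Fin n) F) - 1⁆ *
        ((g⁻¹ : GL (Fin n) F) : Matrix (Fin n) (Fin n) F) := by
  have h1 : ⁅(g : Matrix (Fin n) (Fin n) F) - 1, (h : Matrix (Fin n) (Fin n) F) - 1⁆ =
      (g : Matrix (Fin n) (Fin n) F) * h - h * g := by
    rw [Ring.lie_def]
    noncomm_ring
  have hgi : (g : Matrix (Fin n) (Fin n) F) * ((g⁻¹ : GL (Fin n) F) : Matrix _ _ F) = 1 := by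
    rw [← Units.val_mul, mul_inv_cancel, Units.val_one]
  rw [h1, Units.val_mul, Units.val_mul, sub_mul, mul_assoc (h : Matrix (Fin n) (Fin n) F), hgi,
    mul_one]
  abel

/-- The largest `m` such that the `k`-th derived subgroup of every two-generated unitriangular
group lies in the `m`-th layer. -/
def derivedWeight : ℕ → ℕ
  | 0 => 1
  | 1 => 2
  | 2 => 5
  | 3 => 10
  | k + 4 => 21 * 2 ^ k

theorem one_le_derivedWeight (k : ℕ) : 1 ≤ derivedWeight k := by
  match k with
  | 0 | 1 | 2 | 3 => simp [derivedWeight]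
  | k + 4 =>
    have := Nat.one_le_two_pow (n := k)
    simp only [derivedWeight]
    omega

theorem derivedIn_le_unitriangularGroup {K : Subgroup (GL (Fin n) F)}
    (hK : K ≤ unitriangularGroup n F) (k : ℕ) : derivedIn K k ≤ unitriangularGroup n F :=
  (derivedIn_antitone K (Nat.zero_le k)).trans hK

/-- Reduces each derived step to a bracket computation in the matrix algebra. -/
theorem derivedIn_succ_le_oneAddSubgroup {K : Subgroup (GL (Fin n) F)}
    (hK : K ≤ unitriangularGroup n F) {k m : ℕ} {M M' : Submodule F (Matrix (Fin n) (Fin n) F)}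
    (hm : 1 ≤ m) (hM : M ≤ layer n F m) (hM' : layer n F (m + 1) ≤ M)
    (h : ∀ g ∈ derivedIn K k, (g : Matrix (Fin n) (Fin n) F) - 1 ∈ M')
    (hlie : ∀ x ∈ M', ∀ y ∈ M', ⁅x, y⁆ ∈ M) :
    ∀ g ∈ derivedIn K (k + 1), (g : Matrix (Fin n) (Fin n) F) - 1 ∈ M := by
  have hle : derivedIn K (k + 1) ≤
      oneAddSubgroup M m hm hM ((layer_anti (by omega)).trans hM') := by
    rw [derivedIn_succ, Subgroup.commutator_le]
    intro g₁ h₁ g₂ h₂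
    exact commutator_sub_one_mem hM hM' (derivedIn_le_unitriangularGroup hK k h₁)
      (derivedIn_le_unitriangularGroup hK k h₂) (hlie _ (h _ h₁) _ (h _ h₂))
  exact fun g hg => hle hg

theorem derivedIn_add_le_layerSubgroup {K : Subgroup (GL (Fin n) F)}
    (hK : K ≤ unitriangularGroup n F) {k m : ℕ} (hm : 1 ≤ m)
    (h : ∀ g ∈ derivedIn K k, (g : Matrix (Fin n) (Fin n) F) - 1 ∈ layer n F m) (j : ℕ) :
    ∀ g ∈ derivedIn K (k + j), (g : Matrix (Fin n) (Fin n) F) - 1 ∈ layer n F (m * 2 ^ j) := by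
  induction j with
  | zero => simpa using h
  | succ j ih =>
    have hpos : 1 ≤ m * 2 ^ (j + 1) := Nat.mul_pos hm (by positivity)
    refine derivedIn_succ_le_oneAddSubgroup hK hpos le_rfl (layer_anti (by omega)) ih ?_
    intro x hx y hy
    have := lie_mem_layer hx hy
    rwa [← mul_two, mul_assoc, ← pow_succ] at this

variable {a b : GL (Fin n) F}

theorem closure_pair_sub_one_mem (ha : a ∈ unitriangularGroup n F)
    (hb : b ∈ unitriangularGroup n F) {g : GL (Fin n) F} (hg : g ∈ Subgroup.closure {a, b}) :
    (g : Matrix (Fin n) (Fin n) F) - 1 ∈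
      pairLayer ((a : Matrix (Fin n) (Fin n) F) - 1) ((b : Matrix (Fin n) (Fin n) F) - 1) 2 := by
  have hle : Subgroup.closure {a, b} ≤ oneAddSubgroup (pairLayer
      ((a : Matrix (Fin n) (Fin n) F) - 1) ((b : Matrix (Fin n) (Fin n) F) - 1) 2) 1 le_rfl
      (pairLayer_le (mem_unitriangularGroup_iff.1 ha) (mem_unitriangularGroup_iff.1 hb)
        one_le_two) (layer_le_pairLayer _ _ _) := by
    rw [Subgroup.closure_le]
    rintro _ (rfl | rfl)
    · exact left_mem_pairLayer _ _ _
    · exact right_mem_pairLayer _ _ _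
  exact hle hg

/-- The matrices 1 + w with w of this shape form a subgroup that contains ⁅a, b⁆. Conjugation by the
group changes w by brackets with x and y modulo deeper terms, so the subgroup is normalized and
contains all of G'. -/
theorem derivedIn_one_closure_pair {x y c : Matrix (Fin n) (Fin n) F}
    (ha : a ∈ unitriangularGroup n F) (hb : b ∈ unitriangularGroup n F)
    (hx : x = (a : Matrix (Fin n) (Fin n) F) - 1) (hy : y = (b : Matrix (Fin n) (Fin n) F) - 1)
    (hc : c = ((⁅a, b⁆ : GL (Fin n) F) : Matrix (Fin n) (Fin n) F) - 1) {g : GL (Fin n) F}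
    (hg : g ∈ derivedIn (Subgroup.closure {a, b}) 1) :
    ∃ t : F, ∃ s ∈ pairLayer ⁅c, x⁆ ⁅c, y⁆ 4, (g : Matrix (Fin n) (Fin n) F) - 1 = t • c + s := by
  have hxl : x ∈ layer n F 1 := hx ▸ mem_unitriangularGroup_iff.1 ha
  have hyl : y ∈ layer n F 1 := hy ▸ mem_unitriangularGroup_iff.1 hb
  have hcl : c ∈ layer n F 2 := by
    rw [hc]
    exact commutator_sub_one_mem le_rfl (layer_anti (by omega)) ha hb
      (lie_mem_layer (hx ▸ hxl) (hy ▸ hyl))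
  have hP : pairLayer ⁅c, x⁆ ⁅c, y⁆ 4 ≤ layer n F 3 :=
    pairLayer_le (lie_mem_layer hcl hxl) (lie_mem_layer hcl hyl) (by omega)
  have hM : Submodule.span F {c} ⊔ pairLayer ⁅c, x⁆ ⁅c, y⁆ 4 ≤ layer n F 2 :=
    sup_le (Submodule.span_le.2 (by rintro _ rfl; exact hcl)) (hP.trans (layer_anti (by omega)))
  have hM' : layer n F (2 * 2) ≤ Submodule.span F {c} ⊔ pairLayer ⁅c, x⁆ ⁅c, y⁆ 4 :=
    (layer_le_pairLayer _ _ _).trans le_sup_right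
  have hKU : Subgroup.closure {a, b} ≤ unitriangularGroup n F :=
    (Subgroup.closure_le _).2 (by rintro _ (rfl | rfl) <;> assumption)
  have hle : derivedIn (Subgroup.closure {a, b}) 1 ≤
      oneAddSubgroup (Submodule.span F {c} ⊔ pairLayer ⁅c, x⁆ ⁅c, y⁆ 4) 2 one_le_two hM hM' := by
    refine commutator_closure_pair_le (fun g hg h hh => ?_) ?_
    · rw [mem_oneAddSubgroup] at hh ⊢
      rw [conj_sub_one]
      refine add_mem hh ?_
      have hz := closure_pair_sub_one_mem ha hb hg
      rw [← hx, ← hy] at hz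
      have hzl := pairLayer_le hxl hyl one_le_two hz
      generalize (g : Matrix (Fin n) (Fin n) F) - 1 = z at hz hzl ⊢
      generalize (h : Matrix (Fin n) (Fin n) F) - 1 = w at hh ⊢
      refine (le_sup_right : pairLayer ⁅c, x⁆ ⁅c, y⁆ 4 ≤ _) (mul_mem_of_layer_le hP
        (layer_le_pairLayer _ _ _) (inv_mem (hKU hg)) ?_)
      obtain ⟨s, hs, r, hr, rfl⟩ := Submodule.mem_sup.1 hh
      obtain ⟨t, rfl⟩ := Submodule.mem_span_singleton.1 hs
      exact lie_smul_add_mem_pairLayer_of_mem (k := 2) hxl hyl hcl hz hr t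
    · rw [mem_oneAddSubgroup, ← hc]
      exact (le_sup_left : Submodule.span F {c} ≤ _) (Submodule.mem_span_singleton_self c)
  obtain ⟨s, hs, r, hr, h⟩ := Submodule.mem_sup.1 (mem_oneAddSubgroup.1 (hle hg))
  obtain ⟨t, rfl⟩ := Submodule.mem_span_singleton.1 hs
  exact ⟨t, r, hr, h.symm⟩

theorem derivedIn_closure_pair_sub_one_mem (ha : a ∈ unitriangularGroup n F)
    (hb : b ∈ unitriangularGroup n F) (k : ℕ) :
    ∀ g ∈ derivedIn (Subgroup.closure {a, b}) k,
      (g : Matrix (Fin n) (Fin n) F) - 1 ∈ layer n F (derivedWeight k) := by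
  have hKU : Subgroup.closure {a, b} ≤ unitriangularGroup n F :=
    (Subgroup.closure_le _).2 (by rintro _ (rfl | rfl) <;> assumption)
  obtain ⟨x, hx⟩ : ∃ x, x = (a : Matrix (Fin n) (Fin n) F) - 1 := ⟨_, rfl⟩
  obtain ⟨y, hy⟩ : ∃ y, y = (b : Matrix (Fin n) (Fin n) F) - 1 := ⟨_, rfl⟩
  obtain ⟨c, hc⟩ : ∃ c, c = ((⁅a, b⁆ : GL (Fin n) F) : Matrix (Fin n) (Fin n) F) - 1 := ⟨_, rfl⟩
  have hxl : x ∈ layer n F 1 := hx ▸ mem_unitriangularGroup_iff.1 ha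
  have hyl : y ∈ layer n F 1 := hy ▸ mem_unitriangularGroup_iff.1 hb
  have h0 : ∀ g ∈ derivedIn (Subgroup.closure {a, b}) 0,
      (g : Matrix (Fin n) (Fin n) F) - 1 ∈ layer n F 1 :=
    fun g hg => mem_unitriangularGroup_iff.1 (hKU hg)
  have h1 := derivedIn_add_le_layerSubgroup hKU le_rfl h0 1
  have hcl : c ∈ layer n F 2 := by
    rw [hc]
    exact h1 _ (commutator_mem_derivedIn_succ (Subgroup.subset_closure (Set.mem_insert _ _))
      (Subgroup.subset_closure (Set.mem_insert_of_mem _ rfl)))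
  have hpl : ⁅c, x⁆ ∈ layer n F 3 := lie_mem_layer hcl hxl
  have hql : ⁅c, y⁆ ∈ layer n F 3 := lie_mem_layer hcl hyl
  have hul : ⁅c, ⁅c, x⁆⁆ ∈ layer n F 5 := lie_mem_layer hcl hpl
  have hvl : ⁅c, ⁅c, y⁆⁆ ∈ layer n F 5 := lie_mem_layer hcl hql
  have hel := lie_mem_layer hul hvl
  have hP : pairLayer ⁅c, x⁆ ⁅c, y⁆ 4 ≤ layer n F 3 := pairLayer_le hpl hql (by omega)
  have h2 : ∀ g ∈ derivedIn (Subgroup.closure {a, b}) 2,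
      (g : Matrix (Fin n) (Fin n) F) - 1 ∈ pairLayer ⁅c, ⁅c, x⁆⁆ ⁅c, ⁅c, y⁆⁆ 6 := by
    refine derivedIn_succ_le_oneAddSubgroup (k := 1) (m := 5)
      (M' := Submodule.span F {c} ⊔ pairLayer ⁅c, x⁆ ⁅c, y⁆ 4) hKU (by omega)
      (pairLayer_le hul hvl (by omega)) (layer_le_pairLayer _ _ _) (fun g hg => ?_) ?_
    · obtain ⟨t, s, hs, h⟩ := derivedIn_one_closure_pair ha hb hx hy hc hg
      rw [h]
      exact Submodule.add_mem_sup
        (Submodule.smul_mem _ _ (Submodule.mem_span_singleton_self c)) hs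
    · intro w hw w' hw'
      obtain ⟨s, hs, r, hr, rfl⟩ := Submodule.mem_sup.1 hw
      obtain ⟨t, rfl⟩ := Submodule.mem_span_singleton.1 hs
      obtain ⟨s', hs', r', hr', rfl⟩ := Submodule.mem_sup.1 hw'
      obtain ⟨t', rfl⟩ := Submodule.mem_span_singleton.1 hs'
      exact lie_smul_add_mem_pairLayer (k := 2) hcl hpl hql hr hr' t t'
  have h3 : ∀ g ∈ derivedIn (Subgroup.closure {a, b}) 3, (g : Matrix (Fin n) (Fin n) F) - 1 ∈
      pairLayer ⁅⁅c, ⁅c, x⁆⁆, ⁅c, ⁅c, y⁆⁆⁆ 0 11 :=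
    derivedIn_succ_le_oneAddSubgroup (k := 2) (m := 10) hKU (by omega)
      (pairLayer_le hel (zero_mem _) (by omega)) (layer_le_pairLayer _ _ _) h2
      (fun w hw z hz => lie_mem_pairLayer_self (k := 5) hul hvl hw hz)
  have h4 : ∀ g ∈ derivedIn (Subgroup.closure {a, b}) 4,
      (g : Matrix (Fin n) (Fin n) F) - 1 ∈ layer n F 21 := by
    refine derivedIn_succ_le_oneAddSubgroup (k := 3) (m := 21) hKU (by omega) le_rfl
      (layer_anti (by omega)) h3 (fun w hw z hz => ?_)
    -- With second generator 0 the leading bracket is zero, leaving only the remainder at depth 2 ·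
    -- 10 + 1.
    obtain ⟨p, q, r, hr, h⟩ :=
      mem_pairLayer.1 (lie_mem_pairLayer_self (k := 10) hel (zero_mem (layer n F (5 + 5))) hw hz)
    rw [h, lie_zero, smul_zero, smul_zero, zero_add, zero_add]
    exact hr
  match k with
  | 0 => exact h0
  | 1 => exact h1
  | 2 => exact fun g hg => pairLayer_le hul hvl (by omega) (h2 g hg)
  | 3 => exact fun g hg => pairLayer_le hel (zero_mem _) (by omega) (h3 g hg)
  | k + 4 =>
    rw [add_comm k 4]
    have := derivedIn_add_le_layerSubgroup hKU (by omega) h4 k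
    rwa [show derivedWeight (4 + k) = 21 * 2 ^ k by rw [add_comm, derivedWeight]]

theorem derivedIn_closure_pair_eq_bot (ha : a ∈ unitriangularGroup n F)
    (hb : b ∈ unitriangularGroup n F) {k : ℕ} (hn : n ≤ derivedWeight k) :
    derivedIn (Subgroup.closure {a, b}) k = ⊥ := by
  rw [eq_bot_iff, ← layerSubgroup_eq_bot (one_le_derivedWeight k) hn]
  exact derivedIn_closure_pair_sub_one_mem ha hb k

theorem derivedIn_eq_bot_of_le_two_pow {K : Subgroup (GL (Fin n) F)}
    (hK : K ≤ unitriangularGroup n F) {k : ℕ} (hn : n ≤ 2 ^ k) : derivedIn K k = ⊥ := by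
  rw [eq_bot_iff, ← layerSubgroup_eq_bot Nat.one_le_two_pow hn]
  have := derivedIn_add_le_layerSubgroup (k := 0) hK le_rfl
    (fun g hg => mem_unitriangularGroup_iff.1 (hK hg)) k
  rwa [zero_add, one_mul] at this

end UpperBound

/-! ### Leading words and the sharpness of the depths -/

section LeadingWords

variable {n : ℕ} {F : Type*} [Field F]

/-- The subword of `s` of length `m` starting at position `i`, read as a binary number. -/
def wordValue (s : ℕ → Bool) (i : ℕ) : ℕ → ℕ
  | 0 => 0
  | m + 1 => 2 * wordValue s i m + (s (i + m)).toNat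

theorem wordValue_add (s : ℕ → Bool) (i m k : ℕ) :
    wordValue s i (m + k) = wordValue s i m * 2 ^ k + wordValue s (i + m) k := by
  induction k with
  | zero => simp [wordValue]
  | succ k ih =>
    rw [← add_assoc, wordValue, wordValue, ih, add_assoc i m k]
    ring

theorem wordValue_lt (s : ℕ → Bool) (i m : ℕ) : wordValue s i m < 2 ^ m := by
  induction m with
  | zero => simp [wordValue]
  | succ m ih =>
    have := Bool.toNat_lt (s (i + m))
    rw [wordValue, pow_succ]
    omega

theorem exists_wordValue_eq {m v : ℕ} (hv : v < 2 ^ m) : ∃ s : ℕ → Bool, wordValue s 0 m = v := by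
  -- The letters are the binary digits of v, most significant first; a prefix then reads v with its
  -- last k digits removed.
  have h : ∀ k, ∀ j, j + k = m →
      wordValue (fun t => v.testBit (m - 1 - t)) 0 j = v / 2 ^ k := by
    intro k j
    induction j generalizing k with
    | zero =>
      rintro hk
      rw [wordValue, Nat.div_eq_of_lt]
      rwa [show k = m by omega]
    | succ j ih =>
      intro hk
      rw [wordValue, ih (k + 1) (by omega), zero_add, show m - 1 - j = k by omega,
        Nat.toNat_testBit, pow_succ, ← Nat.div_div_eq_div_mul]
      omega
  exact ⟨_, (h 0 m rfl).trans (by simp)⟩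

/-- `g - 1` starts on the `m`-th superdiagonal; there, the entry at `(i, i + m)` vanishes if the
subword of `s` at `i` has value less than `v`, and does not vanish if the value is `v`. -/
structure HasLead (s : ℕ → Bool) (g : GL (Fin n) F) (m v : ℕ) : Prop where
  pos : 1 ≤ m
  lt : v < 2 ^ m
  mem : (g : Matrix (Fin n) (Fin n) F) - 1 ∈ layer n F m
  eq_zero : ∀ i j : Fin n, (j : ℕ) = i + m → wordValue s i m < v →
    ((g : Matrix (Fin n) (Fin n) F) - 1) i j = 0
  ne_zero : ∀ i j : Fin n, (j : ℕ) = i + m → wordValue s i m = v →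
    ((g : Matrix (Fin n) (Fin n) F) - 1) i j ≠ 0

theorem HasLead.mem_unitriangularGroup {s : ℕ → Bool} {g : GL (Fin n) F} {m v : ℕ}
    (h : HasLead s g m v) : g ∈ unitriangularGroup n F :=
  mem_unitriangularGroup_iff.2 (layer_anti h.pos h.mem)

/-- The product of two leading terms vanishes below the concatenation of the two words. -/
theorem HasLead.mul_apply_eq_zero {s : ℕ → Bool} {g h : GL (Fin n) F} {m k v w : ℕ}
    (hg : HasLead s g m v) (hh : HasLead s h k w) {i j : Fin n} (hj : (j : ℕ) = i + (m + k))
    (hlt : wordValue s i (m + k) < v * 2 ^ k + w) :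
    (((g : Matrix (Fin n) (Fin n) F) - 1) * ((h : Matrix (Fin n) (Fin n) F) - 1)) i j = 0 := by
  rw [mul_apply_of_mem_layer hg.mem hh.mem (l := ⟨i + m, by omega⟩) rfl
    (by dsimp only; omega)]
  rw [wordValue_add] at hlt
  -- As w < 2 ^ k, comparing values is lexicographic comparison, so the third case below contradicts
  -- `hlt`.
  have hw := hh.lt
  rcases lt_trichotomy (wordValue s i m) v with h1 | h1 | h1
  · rw [hg.eq_zero _ _ rfl h1, zero_mul]
  · rw [hh.eq_zero _ _ (by dsimp only; omega) (by rw [h1] at hlt; dsimp only; omega),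
      mul_zero]
  · have := Nat.mul_le_mul_right (2 ^ k) (Nat.succ_le_of_lt h1)
    rw [Nat.succ_mul] at this
    omega

/-- The hypothesis says that the concatenation vw precedes wv. Hence the reversed product vanishes
at vw and cannot cancel the entry there, which is a product of two nonzero field elements. -/
theorem HasLead.commutator {s : ℕ → Bool} {g h : GL (Fin n) F} {m k v w : ℕ}
    (hg : HasLead s g m v) (hh : HasLead s h k w) (hvw : v * 2 ^ k + w < w * 2 ^ m + v) :
    HasLead s ⁅g, h⁆ (m + k) (v * 2 ^ k + w) := by
  have hgU := hg.mem_unitriangularGroup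
  have hhU := hh.mem_unitriangularGroup
  have hlie := lie_mem_layer hg.mem hh.mem
  have happly : ∀ i j : Fin n, (j : ℕ) = i + (m + k) →
      (((⁅g, h⁆ : GL (Fin n) F) : Matrix (Fin n) (Fin n) F) - 1) i j =
      (((g : Matrix (Fin n) (Fin n) F) - 1) * ((h : Matrix (Fin n) (Fin n) F) - 1)) i j -
      (((h : Matrix (Fin n) (Fin n) F) - 1) * ((g : Matrix (Fin n) (Fin n) F) - 1)) i j := by
    intro i j hj
    have hz := mem_unitriangularGroup_iff.1 (inv_mem (mul_mem hhU hgU))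
    rw [commutator_sub_one,
      ← sub_add_cancel (((h * g)⁻¹ : GL (Fin n) F) : Matrix (Fin n) (Fin n) F) 1,
      mul_add, mul_one, Matrix.add_apply, mul_mem_layer hlie hz i j (by omega), zero_add,
      Ring.lie_def, Matrix.sub_apply]
  refine ⟨by have := hg.pos; omega, ?_, ?_, ?_, ?_⟩
  · have := Nat.mul_le_mul_right (2 ^ k) (Nat.succ_le_of_lt hg.lt)
    have hw := hh.lt
    rw [Nat.succ_mul] at this
    rw [pow_add]
    omega
  · exact commutator_sub_one_mem le_rfl (layer_anti (by omega)) hgU hhU hlie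
  · intro i j hj hlt
    rw [happly i j hj, hg.mul_apply_eq_zero hh hj hlt,
      hh.mul_apply_eq_zero hg (by omega) (by rw [add_comm k m]; omega), sub_zero]
  · intro i j hj heq
    rw [happly i j hj, hh.mul_apply_eq_zero hg (by omega) (by rw [add_comm k m]; omega), sub_zero,
      mul_apply_of_mem_layer hg.mem hh.mem (l := ⟨i + m, by omega⟩) rfl
        (by dsimp only; omega)]
    rw [wordValue_add] at heq
    have h1 := wordValue_lt s (i + m) k
    have hw := hh.lt
    have hv : wordValue s i m = v := by
      have hdiv := congrArg (· / 2 ^ k) heq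
      simpa [mul_comm _ (2 ^ k), Nat.mul_add_div (Nat.two_pow_pos k), Nat.div_eq_of_lt h1,
        Nat.div_eq_of_lt hw] using hdiv
    refine mul_ne_zero (hg.ne_zero _ _ rfl hv) (hh.ne_zero _ _ (by dsimp only; omega) ?_)
    rw [hv] at heq
    dsimp only
    omega

theorem exists_hasLead_letter (n : ℕ) (F : Type*) [Field F] (s : ℕ → Bool) (c : Bool) :
    ∃ g : GL (Fin n) F, HasLead s g 1 c.toNat := by
  obtain ⟨g, hg⟩ := exists_coe_sub_one_eq (n := n) (F := F)
    (x := fun i j => if (j : ℕ) = i + 1 ∧ s i = c then 1 else 0)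
    (fun i j hij => if_neg (by omega))
  have hval : ∀ i, wordValue s i 1 = (s i).toNat := fun i => by simp [wordValue]
  refine ⟨g, le_rfl, Bool.toNat_lt c, ?_, ?_, ?_⟩
  · rw [hg]
    exact fun i j hij => if_neg (by omega)
  · intro i j hj hlt
    rw [hval] at hlt
    rw [hg]
    refine if_neg ?_
    rintro ⟨-, rfl⟩
    omega
  · intro i j hj heq
    rw [hval] at heq
    rw [hg]
    have : s i = c := by
      revert heq
      cases s i <;> cases c <;> simp
    dsimp only
    rw [if_pos ⟨hj, this⟩]
    exact one_ne_zero

/-- Some element of the `k`-th derived subgroup of `K` has leading word of length `m`, value `v`. -/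
def DerivedLead (s : ℕ → Bool) (K : Subgroup (GL (Fin n) F)) (k m v : ℕ) : Prop :=
  ∃ g ∈ derivedIn K k, HasLead s g m v

variable {s : ℕ → Bool} {K : Subgroup (GL (Fin n) F)}

theorem DerivedLead.succ {k m₁ m₂ v₁ v₂ : ℕ} (h₁ : DerivedLead s K k m₁ v₁)
    (h₂ : DerivedLead s K k m₂ v₂) (h : v₁ * 2 ^ m₂ + v₂ < v₂ * 2 ^ m₁ + v₁) :
    DerivedLead s K (k + 1) (m₁ + m₂) (v₁ * 2 ^ m₂ + v₂) := by
  obtain ⟨g₁, hg₁, hl₁⟩ := h₁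
  obtain ⟨g₂, hg₂, hl₂⟩ := h₂
  exact ⟨⁅g₁, g₂⁆, commutator_mem_derivedIn_succ hg₁ hg₂, hl₁.commutator hl₂ h⟩

/-- Derived subgroups are normal in K, so a word can be lengthened without changing its derived
level. -/
theorem DerivedLead.lie_left {k m₁ m₂ v₁ v₂ : ℕ} (h₁ : DerivedLead s K 0 m₁ v₁)
    (h₂ : DerivedLead s K k m₂ v₂) (h : v₁ * 2 ^ m₂ + v₂ < v₂ * 2 ^ m₁ + v₁) :
    DerivedLead s K k (m₁ + m₂) (v₁ * 2 ^ m₂ + v₂) := by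
  obtain ⟨g₁, hg₁, hl₁⟩ := h₁
  obtain ⟨g₂, hg₂, hl₂⟩ := h₂
  exact ⟨⁅g₁, g₂⁆, commutator_mem_derivedIn hg₁ hg₂, hl₁.commutator hl₂ h⟩

theorem DerivedLead.lie_right {k m₁ m₂ v₁ v₂ : ℕ} (h₁ : DerivedLead s K k m₁ v₁)
    (h₂ : DerivedLead s K 0 m₂ v₂) (h : v₁ * 2 ^ m₂ + v₂ < v₂ * 2 ^ m₁ + v₁) :
    DerivedLead s K k (m₁ + m₂) (v₁ * 2 ^ m₂ + v₂) := by
  obtain ⟨g₁, hg₁, hl₁⟩ := h₁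
  obtain ⟨g₂, hg₂, hl₂⟩ := h₂
  refine ⟨⁅g₁, g₂⁆, ?_, hl₁.commutator hl₂ h⟩
  rw [← commutatorElement_inv]
  exact inv_mem (commutator_mem_derivedIn hg₂ hg₁)

/-- Three leading words of one length in a derived subgroup yield three in the next one. -/
theorem exists_three_derivedLead {k m : ℕ}
    (hbase : ∃ u v w, u < v ∧ v < w ∧ w < 2 ^ m ∧ ∀ s : ℕ → Bool, ∀ K : Subgroup (GL (Fin n) F),
      DerivedLead s K 0 1 0 → DerivedLead s K 0 1 1 →
      DerivedLead s K k m u ∧ DerivedLead s K k m v ∧ DerivedLead s K k m w) (j : ℕ) :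
    ∃ u v w, u < v ∧ v < w ∧ w < 2 ^ (m * 2 ^ j) ∧
      ∀ s : ℕ → Bool, ∀ K : Subgroup (GL (Fin n) F),
      DerivedLead s K 0 1 0 → DerivedLead s K 0 1 1 →
      DerivedLead s K (k + j) (m * 2 ^ j) u ∧ DerivedLead s K (k + j) (m * 2 ^ j) v ∧
        DerivedLead s K (k + j) (m * 2 ^ j) w := by
  induction j with
  | zero => simpa using hbase
  | succ j ih =>
    obtain ⟨u, v, w, huv, hvw, hw, h⟩ := ih
    rw [pow_succ, ← mul_assoc, mul_two]
    generalize m * 2 ^ j = l at hw h ⊢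
    have swap : ∀ {x y : ℕ}, x < y → y < 2 ^ l → x * 2 ^ l + y < y * 2 ^ l + x := by
      intro x y hxy hy
      have := Nat.mul_le_mul_right (2 ^ l) (Nat.succ_le_of_lt hxy)
      rw [Nat.succ_mul] at this
      omega
    -- From u < v < w of equal length come uv < uw < vw.
    refine ⟨u * 2 ^ l + v, u * 2 ^ l + w, v * 2 ^ l + w, by omega, ?_, ?_, fun s K hA hB => ?_⟩
    · have := Nat.mul_lt_mul_of_pos_right huv (Nat.two_pow_pos l)
      omega
    · have := Nat.mul_le_mul_right (2 ^ l) (Nat.succ_le_of_lt (hvw.trans hw))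
      rw [Nat.succ_mul] at this
      rw [pow_add]
      omega
    · obtain ⟨hu, hv, hw'⟩ := h s K hA hB
      exact ⟨hu.succ hv (swap huv (hvw.trans hw)), hu.succ hw' (swap (huv.trans hvw) hw),
        hv.succ hw' (swap hvw hw)⟩

/-- The binary literals spell the leading words, with 0 for a and 1 for b. The value v is
independent of s, so that s can later be chosen to begin with it. -/
theorem exists_derivedLead_derivedWeight (n : ℕ) (F : Type*) [Field F] (k : ℕ) :
    ∃ v, v < 2 ^ derivedWeight k ∧ ∀ s : ℕ → Bool, ∀ K : Subgroup (GL (Fin n) F),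
      DerivedLead s K 0 1 0 → DerivedLead s K 0 1 1 →
      DerivedLead s K k (derivedWeight k) v := by
  have ab : ∀ {s : ℕ → Bool} {K : Subgroup (GL (Fin n) F)}, DerivedLead s K 0 1 0 →
      DerivedLead s K 0 1 1 → DerivedLead s K 1 2 0b01 :=
    fun hA hB => hA.succ hB (by norm_num)
  have aab : ∀ {s : ℕ → Bool} {K : Subgroup (GL (Fin n) F)}, DerivedLead s K 0 1 0 →
      DerivedLead s K 0 1 1 → DerivedLead s K 1 3 0b001 :=
    fun hA hB => hA.lie_left (ab hA hB) (by norm_num)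
  have abb : ∀ {s : ℕ → Bool} {K : Subgroup (GL (Fin n) F)}, DerivedLead s K 0 1 0 →
      DerivedLead s K 0 1 1 → DerivedLead s K 1 3 0b011 :=
    fun hA hB => (ab hA hB).lie_right hB (by norm_num)
  have u : ∀ {s : ℕ → Bool} {K : Subgroup (GL (Fin n) F)}, DerivedLead s K 0 1 0 →
      DerivedLead s K 0 1 1 → DerivedLead s K 2 5 0b00101 :=
    fun hA hB => (aab hA hB).succ (ab hA hB) (by norm_num)
  have v : ∀ {s : ℕ → Bool} {K : Subgroup (GL (Fin n) F)}, DerivedLead s K 0 1 0 →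
      DerivedLead s K 0 1 1 → DerivedLead s K 2 5 0b01011 :=
    fun hA hB => (ab hA hB).succ (abb hA hB) (by norm_num)
  have e : ∀ {s : ℕ → Bool} {K : Subgroup (GL (Fin n) F)}, DerivedLead s K 0 1 0 →
      DerivedLead s K 0 1 1 → DerivedLead s K 3 10 0b0010101011 :=
    fun hA hB => (u hA hB).succ (v hA hB) (by norm_num)
  match k with
  | 0 => exact ⟨0, by norm_num, fun s K hA _ => hA⟩
  | 1 => exact ⟨_, by norm_num [derivedWeight], fun s K hA hB => ab hA hB⟩
  | 2 => exact ⟨_, by norm_num [derivedWeight], fun s K hA hB => u hA hB⟩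
  | 3 => exact ⟨_, by norm_num [derivedWeight], fun s K hA hB => e hA hB⟩
  | k + 4 =>
    -- At level 3 depth 10 is led by a single element, so depth 21 is reached by pairing `e` with
    -- three words of length 11.
    have hbase : ∀ s : ℕ → Bool, ∀ K : Subgroup (GL (Fin n) F),
        DerivedLead s K 0 1 0 → DerivedLead s K 0 1 1 →
        DerivedLead s K 4 21 0b000101001010010101011 ∧
        DerivedLead s K 4 21 0b000101010110010101011 ∧
        DerivedLead s K 4 21 0b001010011010010101011 := by
      intro s K hA hB
      have aaab : DerivedLead s K 1 4 0b0001 := hA.lie_left (aab hA hB) (by norm_num)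
      have aabb : DerivedLead s K 1 4 0b0011 := (aab hA hB).lie_right hB (by norm_num)
      have w₁ : DerivedLead s K 2 6 0b000101 := aaab.succ (ab hA hB) (by norm_num)
      have w₂ : DerivedLead s K 2 6 0b001101 := aabb.succ (ab hA hB) (by norm_num)
      have x₁ : DerivedLead s K 3 11 0b00010100101 := w₁.succ (u hA hB) (by norm_num)
      have x₂ : DerivedLead s K 3 11 0b00010101011 := w₁.succ (v hA hB) (by norm_num)
      have x₃ : DerivedLead s K 3 11 0b00101001101 := (u hA hB).succ w₂ (by norm_num)
      exact ⟨x₁.succ (e hA hB) (by norm_num), x₂.succ (e hA hB) (by norm_num),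
        x₃.succ (e hA hB) (by norm_num)⟩
    obtain ⟨x, _, _, hxy, hyz, hz, h⟩ := exists_three_derivedLead
      ⟨_, _, _, by norm_num, by norm_num, by norm_num, hbase⟩ k
    rw [add_comm k 4, show derivedWeight (4 + k) = 21 * 2 ^ k by rw [add_comm, derivedWeight]]
    exact ⟨x, (hxy.trans hyz).trans hz, fun s K hA hB => (h s K hA hB).1⟩

theorem exists_derivedIn_closure_pair_ne_bot {k : ℕ} (hn : derivedWeight k < n) :
    ∃ a ∈ unitriangularGroup n F, ∃ b ∈ unitriangularGroup n F,
      derivedIn (Subgroup.closure {a, b}) k ≠ ⊥ := by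
  obtain ⟨v, hv, h⟩ := exists_derivedLead_derivedWeight n F k
  -- Since s starts with the leading word, the entry in row 0 and column `derivedWeight k` is
  -- nonzero; that column exists because `derivedWeight k < n`.
  obtain ⟨s, hs⟩ := exists_wordValue_eq hv
  obtain ⟨a, ha⟩ := exists_hasLead_letter n F s false
  obtain ⟨b, hb⟩ := exists_hasLead_letter n F s true
  obtain ⟨g, hg, hl⟩ := h s (Subgroup.closure {a, b})
    ⟨a, Subgroup.subset_closure (Set.mem_insert _ _), ha⟩
    ⟨b, Subgroup.subset_closure (Set.mem_insert_of_mem _ rfl), hb⟩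
  refine ⟨a, ha.mem_unitriangularGroup, b, hb.mem_unitriangularGroup, fun hbot => ?_⟩
  rw [hbot, Subgroup.mem_bot] at hg
  refine hl.ne_zero ⟨0, by omega⟩ ⟨derivedWeight k, hn⟩ (Nat.zero_add _).symm hs ?_
  rw [hg, Units.val_one, sub_self, Matrix.zero_apply]

end LeadingWords

/-! ### Translation to derived length and the numerical bound -/

section MainTheorem

theorem derivedSeries_subgroup_eq_bot_iff {G : Type*} [Group G] {U : Subgroup G} (H : Subgroup U)
    (k : ℕ) : derivedSeries H k = ⊥ ↔ derivedIn (H.map U.subtype) k = ⊥ := by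
  rw [derivedSeries_eq_bot_iff (U.subtype.comp H.subtype)
    (U.subtype_injective.comp H.subtype_injective), MonoidHom.range_comp, Subgroup.range_subtype]

theorem map_subtype_closure_pair {G : Type*} [Group G] {U : Subgroup G} (a b : U) :
    (Subgroup.closure {a, b}).map U.subtype = Subgroup.closure {(a : G), (b : G)} := by
  rw [MonoidHom.map_closure, Set.image_pair]
  rfl

/-- The weight is the integer part of (21/32) · 2^(k+1), also for the small exceptional values 1, 2,
5, 10. -/
theorem derivedWeight_lt_iff (k n : ℕ) :
    derivedWeight k < n ↔ (21 / 32 : ℝ) * 2 ^ (k + 1) < (n : ℝ) := by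
  have key : (21 / 32 : ℝ) * 2 ^ (k + 1) < (n : ℝ) ↔ 21 * 2 ^ (k + 1) < 32 * n := by
    rw [← Nat.cast_lt (α := ℝ)]
    push_cast
    constructor <;> intro h <;> linarith
  rw [key]
  match k with
  | 0 | 1 | 2 | 3 => simp only [derivedWeight]; omega
  | k + 4 =>
    rw [derivedWeight, show 2 ^ (k + 4 + 1) = 2 ^ k * 32 by ring]
    omega

end MainTheorem

theorem theorem3p4 {F : Type*} [Field F] (n d : ℕ) (hn : 1 ≤ n)
    (hd : d = ⌈Real.logb 2 (n : ℝ)⌉₊) :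
    (∃ H : Subgroup (unitriangularGroup n F), IsTwoGenerated H ∧ HasDerivedLength H d) ↔
      (21 / 32 : ℝ) * 2 ^ d < (n : ℝ) ∧ (n : ℝ) ≤ 2 ^ d := by
  have hle : (n : ℝ) ≤ 2 ^ d := by
    have h : Real.logb 2 (n : ℝ) ≤ d := hd ▸ Nat.le_ceil _
    rwa [Real.logb_le_iff_le_rpow one_lt_two (by exact_mod_cast hn), Real.rpow_natCast] at h
  have hle' : n ≤ 2 ^ d := by exact_mod_cast hle
  -- The bound n ≤ 2^d is automatic from the choice of d.
  rw [and_iff_left hle]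
  rcases d with _ | k
  · have hn1 : n = 1 := le_antisymm (by simpa using hle') hn
    refine iff_of_true ⟨Subgroup.closure {1, 1}, ⟨1, 1, rfl⟩, ?_, fun _ _ => Nat.zero_le _⟩ ?_
    · rw [Set.mem_ofPred_eq, derivedSeries_subgroup_eq_bot_iff]
      exact derivedIn_eq_bot_of_le_two_pow (Subgroup.map_subtype_le _) hle'
    · rw [hn1]
      norm_num
  · rw [← derivedWeight_lt_iff]
    constructor
    · rintro ⟨H, ⟨a, b, rfl⟩, hH⟩
      by_contra! hlt
      have hbot := derivedIn_closure_pair_eq_bot a.2 b.2 hlt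
      rw [← map_subtype_closure_pair, ← derivedSeries_subgroup_eq_bot_iff] at hbot
      have := hH.2 hbot
      omega
    · intro hlt
      obtain ⟨a, ha, b, hb, hne⟩ := exists_derivedIn_closure_pair_ne_bot (F := F) hlt
      refine ⟨Subgroup.closure {⟨a, ha⟩, ⟨b, hb⟩}, ⟨_, _, rfl⟩, ?_, fun j hj => ?_⟩
      · rw [Set.mem_ofPred_eq, derivedSeries_subgroup_eq_bot_iff]
        exact derivedIn_eq_bot_of_le_two_pow (Subgroup.map_subtype_le _) hle'
      · rw [Set.mem_ofPred_eq, derivedSeries_subgroup_eq_bot_iff, map_subtype_closure_pair] at hj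
        by_contra! hlt'
        exact hne (eq_bot_iff.2 ((derivedIn_antitone _ (Nat.le_of_lt_succ hlt')).trans hj.le))
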